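/- Let $1\le N\le\infty$ and $E=\{i\in\mathbb Z:\,0\le i<N+1\}$. Consider a birth--death process on $E$ with birth rates $b_i>0$ for $0\le i<N$ ($b_N=0$ if $N<\infty$) and death rates $a_i>0$ for $1\le i<N+1$. Put $\mu_0=1$, $\mu_n=\dfrac{b_0\cdots b_{n-1}}{a_1\cdots a_n}$ for $1\le n<N+1$, and assume $$Z:=\sum_{i=0}^N\mu_i<\infty .$$ For $f:E\to\mathbb R$ write $\mu(f)=\sum_{i\in E}\mu_if_i$ and $D(f)=\sum_{0\le i<N}\mu_ib_i(f_{i+1}-f_i)^2\in[0,\infty]$, and let $$\lambda_1=\inf\big\{D(f):\ f\in L^2(\mu),\ D(f)<\infty,\ \mu(f)=0,\ \mu(f^2)=1\big\}$$ be the spectral gap of the maximal Dirichlet form $(D,\mathcal D^{\max}(D))$, $\mathcal D^{\max}(D)=\{f\in L^2(\mu):D(f)<\infty\}$. Define $\kappa\in(0,\infty]$ by $$\kappa^{-1}=\inf_{0\le n<m<N+1}\Bigg[\bigg(\sum_{i=0}^{n}\mu_i\bigg)^{-1}+\bigg(\sum_{i=m}^{N}\mu_i\bigg)^{-1}\Bigg]\bigg(\sum_{j=n}^{m-1}\frac1{\mu_jb_j}\bigg)^{-1},$$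 with the convention $1/\infty=0$, $1/0=\infty$. Then $$\frac{\kappa^{-1}}4\le\lambda_1\le\kappa^{-1}.$$ Furthermore, with $$\delta_L=\sup_{1\le n<N+1}\ \sum_{i=1}^n\frac1{\mu_ia_i}\sum_{j=n}^N\mu_j,\qquad \delta_R=\sup_{0\le m<N}\ \sum_{j=0}^m\mu_j\sum_{k=m}^{N-1}\frac1{\mu_kb_k}$$ (values in $(0,\infty]$), one has $$\min(\delta_L,\delta_R)\ \ge\ \kappa\ \ge\ Z^{-1}\delta_L .$$ Moreover, $\delta_L$ is equal to the constant $\delta$ of the process with the same rates on $\{i:1\le i<N+1\}$ absorbed at $0$, that is, $$\delta_L=\sup_{1\le n<N+1}\ \sum_{i=1}^n\frac1{\tilde\mu_ia_i}\sum_{j=n}^N\tilde\mu_j,\qquad \tilde\mu_1=1,\quad \tilde\mu_n=\frac{b_1\cdots b_{n-1}}{a_2\cdots a_n}\ \ (2\le n<N+1).$$ -/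

import Mathlib

open scoped ENNReal

/-- Birth rates `b i` and death rates `a i` of a birth--death process with reflecting
boundaries on the state space `E = {i : ℕ | i < N + 1}`, where `1 ≤ N ≤ ∞`:
`b i > 0` for `0 ≤ i < N`, `b N = 0` if `N < ∞`, and `a i > 0` for `i ∈ E`, `i ≥ 1`.
The values `a 0` and `a i`, `b i` for `i ∉ E` play no role. -/
structure BirthDeathRates (N : ℕ∞) where
  a : ℕ → ℝ
  b : ℕ → ℝ
  N_pos : 0 < N
  b_pos : ∀ i : ℕ, (i : ℕ∞) < N → 0 < b i
  b_last : ∀ i : ℕ, (i : ℕ∞) = N → b i = 0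
  a_pos : ∀ i : ℕ, 1 ≤ i → (i : ℕ∞) ≤ N → 0 < a i

namespace BirthDeathRates

variable {N : ℕ∞} (X : BirthDeathRates N)

/-- The reversible measure: `μ 0 = 1`, `μ n = (b 0 ⋯ b (n-1)) / (a 1 ⋯ a n)`. -/
noncomputable def mu (n : ℕ) : ℝ :=
  ∏ j ∈ Finset.range n, X.b j / X.a (j + 1)

/-- The head `μ[0, n] = ∑_{i=0}^n μ i`. -/
noncomputable def head (n : ℕ) : ℝ≥0∞ :=
  ∑ i ∈ Finset.range (n + 1), ENNReal.ofReal (X.mu i)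

/-- The tail `μ[m, N] = ∑_{i=m}^N μ i`, in `[0, ∞]`. -/
noncomputable def tail (m : ℕ) : ℝ≥0∞ :=
  ∑' i : {i : ℕ // m ≤ i ∧ (i : ℕ∞) ≤ N}, ENNReal.ofReal (X.mu i)

/-- The total mass `Z = ∑_{i=0}^N μ i`, in `[0, ∞]`. -/
noncomputable def Z : ℝ≥0∞ := X.tail 0

/-- The form `D(f) = ∑_{0 ≤ i < N} μ i * b i * (f (i+1) - f i)^2`, in `[0, ∞]`.
Only the restriction of `f` to the state space enters. -/
noncomputable def energy (f : ℕ → ℝ) : ℝ≥0∞ :=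
  ∑' i : {i : ℕ // (i : ℕ∞) < N},
    ENNReal.ofReal (X.mu i * X.b i * (f (i + 1) - f i) ^ 2)

/-- `f ∈ L²(μ)`. -/
def InL2 (f : ℕ → ℝ) : Prop :=
  Summable fun i : {i : ℕ // (i : ℕ∞) ≤ N} => X.mu i * f i ^ 2

/-- The maximal domain `{f ∈ L²(μ) : D(f) < ∞}`. -/
def maxDomain : Set (ℕ → ℝ) :=
  {f | X.InL2 f ∧ X.energy f < ⊤}

/-- `λ₁ = inf {D(f) : μ(f) = 0, μ(f²) = 1}`, the infimum being over the maximal domain. -/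
noncomputable def lambda1 : ℝ≥0∞ :=
  ⨅ f ∈ {f : ℕ → ℝ | f ∈ X.maxDomain ∧
      HasSum (fun i : {i : ℕ // (i : ℕ∞) ≤ N} => X.mu i * f i) 0 ∧
      HasSum (fun i : {i : ℕ // (i : ℕ∞) ≤ N} => X.mu i * f i ^ 2) 1},
    X.energy f

/-- The constant `κ⁻¹`, the infimum over all pairs `0 ≤ n < m < N + 1` of
`[(∑_{i=0}^n μ i)⁻¹ + (∑_{i=m}^N μ i)⁻¹] * (∑_{j=n}^{m-1} 1 / (μ j * b j))⁻¹`. -/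
noncomputable def kappaInv : ℝ≥0∞ :=
  ⨅ (n : ℕ) (m : ℕ) (_ : n < m) (_ : (m : ℕ∞) ≤ N),
    ((X.head n)⁻¹ + (X.tail m)⁻¹) *
      (∑ j ∈ Finset.Ico n m, ENNReal.ofReal (1 / (X.mu j * X.b j)))⁻¹

/-- `κ`, in `[0, ∞]`. -/
noncomputable def kappa : ℝ≥0∞ := (X.kappaInv)⁻¹

/-- `δ_L`, the supremum over `1 ≤ n < N + 1` of
`(∑_{i=1}^n 1 / (μ i * a i)) * ∑_{j=n}^N μ j`. -/
noncomputable def deltaL : ℝ≥0∞ :=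
  ⨆ (n : ℕ) (_ : 1 ≤ n) (_ : (n : ℕ∞) ≤ N),
    (∑ i ∈ Finset.Icc 1 n, ENNReal.ofReal (1 / (X.mu i * X.a i))) * X.tail n

/-- `δ_R`, the supremum over `0 ≤ m < N` of
`(∑_{j=0}^m μ j) * ∑_{k=m}^{N-1} 1 / (μ k * b k)`. -/
noncomputable def deltaR : ℝ≥0∞ :=
  ⨆ (m : ℕ) (_ : (m : ℕ∞) < N),
    X.head m *
      ∑' k : {k : ℕ // m ≤ k ∧ (k : ℕ∞) < N}, ENNReal.ofReal (1 / (X.mu k * X.b k))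

/-- The reversible measure of the process on `{i : ℕ | 1 ≤ i < N + 1}` with the same rates and
an absorbing boundary at `0`, normalized at `1`:
`μ 1 = 1`, `μ n = (b 1 ⋯ b (n-1)) / (a 2 ⋯ a n)`. -/
noncomputable def muAbs (n : ℕ) : ℝ :=
  ∏ j ∈ Finset.Ico 1 n, X.b j / X.a (j + 1)

/-- The constant `δ` of the process with an absorbing boundary at `0`: the supremum over
`1 ≤ n < N + 1` of `(∑_{i=1}^n 1 / (μ i * a i)) * ∑_{j=n}^N μ j`, where `μ = muAbs`. -/
noncomputable def deltaAbs : ℝ≥0∞ :=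
  ⨆ (n : ℕ) (_ : 1 ≤ n) (_ : (n : ℕ∞) ≤ N),
    (∑ i ∈ Finset.Icc 1 n, ENNReal.ofReal (1 / (X.muAbs i * X.a i))) *
      ∑' j : {j : ℕ // n ≤ j ∧ (j : ℕ∞) ≤ N}, ENNReal.ofReal (X.muAbs j)

end BirthDeathRates

/-! Lower bound on `lambda1`. Let `H n`, `T m` be head and tail masses, `S` the scale (partial sums
of the edge resistances) and `K = κ`. Dividing by `H n * T m`, the definition of κ reads `S m - K /
T m ≤ S n + K / H n` for `n < m`, so one point `s` of the scale separates all left sides from all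
right sides. Cutting the chain at `s` leaves two half-chains, each with Muckenhoupt constant at most
`K` relative to a Dirichlet condition at `s`. The one-sided Hardy inequality, with its factor 4,
bounds the second moment of `f` about its interpolated value at `s`, hence the variance
(`exists_balanced_point`, `poincare_of_two_sided`).

Upper bound: a ramp that is linear in the scale between `n` and `m` (`exists_ramp`).

Finite and infinite `N` are treated together by extending to ℕ with zero weight and unit conductance
beyond `N`, functions being frozen there. The comparisons with `deltaL` and `deltaR` hold term by
term. -/

/-! ### One-sided Hardy inequalities. -/

/-- A finite weighted Hardy inequality with the constant `4`: here `x` is a scale,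
`T` a decreasing tail of the weights `T i - T (i + 1)`, and `E` bounds the energy on the edges. -/
theorem hardy_finite (n : ℕ) (x T g E : ℕ → ℝ) (d : ℝ) (hx0 : 0 ≤ x 0)
    (hx : ∀ i < n, x i ≤ x (i + 1)) (hT : ∀ i ≤ n + 1, 0 ≤ T i)
    (hTa : ∀ i ≤ n, T (i + 1) ≤ T i) (hE : ∀ i < n, 0 ≤ E i) (hg0 : g 0 = 0)
    (hg : ∀ i < n, (g (i + 1) - g i) ^ 2 ≤ E i * (x (i + 1) - x i))
    (hxT : ∀ i ≤ n, x i * T i ≤ d) :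
    ∑ i ∈ Finset.range n, (T (i + 1) - T (i + 2)) * g (i + 1) ^ 2
      ≤ 4 * d * ∑ i ∈ Finset.range n, E i := by
  have hxn : ∀ i ≤ n, 0 ≤ x i := by
    intro i
    induction i with
    | zero => intro _; exact hx0
    | succ i ih => intro hi; exact (ih (by omega)).trans (hx i (by omega))
  set y : ℕ → ℝ := fun i => √(x i) with hy
  set t : ℕ → ℝ := fun i => √(T i) with ht
  have hy0 : ∀ i, 0 ≤ y i := fun i => Real.sqrt_nonneg _
  have ht0 : ∀ i, 0 ≤ t i := fun i => Real.sqrt_nonneg _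
  have hysq : ∀ i ≤ n, y i ^ 2 = x i := fun i hi => Real.sq_sqrt (hxn i hi)
  have htsq : ∀ i ≤ n + 1, t i ^ 2 = T i := fun i hi => Real.sq_sqrt (hT i hi)
  have hym : ∀ i < n, y i ≤ y (i + 1) := fun i hi => Real.sqrt_le_sqrt (hx i hi)
  have hta : ∀ i ≤ n, t (i + 1) ≤ t i := fun i hi => Real.sqrt_le_sqrt (hTa i hi)
  have hd : 0 ≤ d := (mul_nonneg (hxn 0 (Nat.zero_le _)) (hT 0 (Nat.zero_le _))).trans
    (hxT 0 (Nat.zero_le _))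
  have hyt : ∀ i ≤ n, y i * t i ≤ √d := by
    intro i hi
    rw [hy, ht, ← Real.sqrt_mul (hxn i hi)]
    exact Real.sqrt_le_sqrt (hxT i hi)
  have hdsq : √d ^ 2 = d := Real.sq_sqrt hd
  -- Cauchy–Schwarz with weight `y = √x`: the increment of `x = y ^ 2` is at most `y (j + 1) * 2 *
  -- (y (j + 1) - y j)`, and the last factor telescopes. This gives the first factor 2.
  have hgi : ∀ i ≤ n, g i ^ 2 ≤ (∑ j ∈ Finset.range i, E j * y (j + 1)) * (2 * y i) := by
    intro i hi
    have h1 : g i = ∑ j ∈ Finset.range i, (g (j + 1) - g j) := by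
      rw [Finset.sum_range_sub, hg0, sub_zero]
    have h2 : ∑ j ∈ Finset.range i, 2 * (y (j + 1) - y j) ≤ 2 * y i := by
      rw [← Finset.mul_sum, Finset.sum_range_sub]
      linarith [hy0 0]
    have h3 : (∑ j ∈ Finset.range i, (g (j + 1) - g j)) ^ 2 ≤
        (∑ j ∈ Finset.range i, E j * y (j + 1)) *
          ∑ j ∈ Finset.range i, 2 * (y (j + 1) - y j) := by
      apply Finset.sum_sq_le_sum_mul_sum_of_sq_le_mul
      · intro j hj
        exact mul_nonneg (hE j (by simp at hj; omega)) (hy0 _)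
      · intro j hj
        linarith [hym j (by simp at hj; omega)]
      · intro j hj
        have hj' : j < n := by simp at hj; omega
        refine (hg j hj').trans ?_
        rw [mul_assoc]
        refine mul_le_mul_of_nonneg_left ?_ (hE j hj')
        rw [← hysq j (by omega), ← hysq (j + 1) (by omega)]
        nlinarith [hym j hj', hy0 j]
    rw [h1]
    refine h3.trans (mul_le_mul_of_nonneg_left h2 ?_)
    exact Finset.sum_nonneg fun j hj => mul_nonneg (hE j (by simp at hj; omega)) (hy0 _)
  -- The same factorisation for `T = t ^ 2`, combined with `y * t ≤ √d`, gives the second factor 2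
  -- and another telescoping sum.
  have hw : ∀ i < n, (T (i + 1) - T (i + 2)) * y (i + 1) ≤ 2 * √d * (t (i + 1) - t (i + 2)) := by
    intro i hi
    rw [← htsq (i + 1) (by omega), ← htsq (i + 2) (by omega)]
    have h1 := hyt (i + 1) (by omega)
    have h2 := hta (i + 1) (by omega)
    have h3 : y (i + 1) * (t (i + 1) + t (i + 2)) ≤ 2 * √d := by
      nlinarith [hy0 (i + 1)]
    nlinarith
  have htail : ∀ j < n, y (j + 1) *
      ∑ i ∈ Finset.Ico j n, (T (i + 1) - T (i + 2)) * y (i + 1) ≤ 2 * d := by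
    intro j hj
    have h1 : ∑ i ∈ Finset.Ico j n, (T (i + 1) - T (i + 2)) * y (i + 1)
        ≤ ∑ i ∈ Finset.Ico j n, 2 * √d * (t (i + 1) - t (i + 2)) :=
      Finset.sum_le_sum fun i hi => hw i (Finset.mem_Ico.1 hi).2
    have h2 : ∑ i ∈ Finset.Ico j n, (t (i + 1) - t (i + 2)) = t (j + 1) - t (n + 1) := by
      have := Finset.sum_Ico_sub (fun i => t (i + 1)) hj.le
      rw [← neg_inj, ← Finset.sum_neg_distrib]
      simpa using this
    rw [← Finset.mul_sum, h2] at h1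
    have h4 := hyt (j + 1) (by omega)
    calc _ ≤ y (j + 1) * (2 * √d * (t (j + 1) - t (n + 1))) :=
          mul_le_mul_of_nonneg_left h1 (hy0 _)
      _ ≤ 2 * √d * (y (j + 1) * t (j + 1)) := by
          have := mul_nonneg (mul_nonneg (hy0 (j + 1)) (Real.sqrt_nonneg d)) (ht0 (n + 1))
          linarith
      _ ≤ 2 * √d * √d := mul_le_mul_of_nonneg_left h4 (by positivity)
      _ = 2 * d := by rw [mul_assoc, ← sq, hdsq]
  calc ∑ i ∈ Finset.range n, (T (i + 1) - T (i + 2)) * g (i + 1) ^ 2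
      ≤ ∑ i ∈ Finset.range n, ∑ j ∈ Finset.range (i + 1),
          2 * (E j * (y (j + 1) * ((T (i + 1) - T (i + 2)) * y (i + 1)))) := by
        refine Finset.sum_le_sum fun i hi => ?_
        have hi' : i < n := Finset.mem_range.1 hi
        refine (mul_le_mul_of_nonneg_left (hgi (i + 1) hi')
          (sub_nonneg.2 (hTa (i + 1) hi'))).trans_eq ?_
        rw [Finset.sum_mul, Finset.mul_sum]
        exact Finset.sum_congr rfl fun j _ => by ring
    _ = ∑ j ∈ Finset.range n, ∑ i ∈ Finset.Ico j n,
          2 * (E j * (y (j + 1) * ((T (i + 1) - T (i + 2)) * y (i + 1)))) := by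
        apply Finset.sum_comm'
        intro i j
        simp only [Finset.mem_range, Finset.mem_Ico]
        omega
    _ ≤ ∑ j ∈ Finset.range n, 4 * d * E j := by
        refine Finset.sum_le_sum fun j hj => ?_
        have hj' : j < n := Finset.mem_range.1 hj
        rw [← Finset.mul_sum, ← Finset.mul_sum, ← Finset.mul_sum]
        nlinarith [mul_le_mul_of_nonneg_left (htail j hj') (hE j hj')]
    _ = _ := by rw [Finset.mul_sum]

/-- The right half of the variance estimate. -/
theorem hardy_right (w c f : ℕ → ℝ) (S : ℕ → ℝ) (K s a E₀ : ℝ) (k M : ℕ)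
    (hw : ∀ i, 0 ≤ w i) (hws : Summable w) (hc : ∀ i, 0 < c i)
    (hS : ∀ i, S (i + 1) = S i + 1 / c i) (hK : 0 ≤ K)
    (hT : ∀ m, (∑' i, w (m + i)) * (S m - s) ≤ K) (hs : s ≤ S (k + 1))
    (hE₀ : 0 ≤ E₀) (ha : (f (k + 1) - a) ^ 2 ≤ E₀ * (S (k + 1) - s)) :
    ∑ i ∈ Finset.range M, w (k + 1 + i) * (f (k + 1 + i) - a) ^ 2 ≤
      4 * K * (E₀ + ∑ i ∈ Finset.range M, c (k + 1 + i) * (f (k + 2 + i) - f (k + 1 + i)) ^ 2) := by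
  have hsum : ∀ m, Summable fun i => w (m + i) := fun m => by
    simpa [add_comm] using (summable_nat_add_iff m).2 hws
  have hTd : ∀ m, ∑' i, w (m + i) - ∑' i, w (m + 1 + i) = w m := by
    intro m
    rw [(hsum m).tsum_eq_zero_add]
    have h1 : ∀ b, w (m + (b + 1)) = w (m + 1 + b) := fun b => by rw [add_right_comm, add_assoc]
    rw [tsum_congr h1, add_zero, add_sub_cancel_right]
  have hE : ∀ i, 0 ≤ c (k + 1 + i) * (f (k + 2 + i) - f (k + 1 + i)) ^ 2 := fun i =>
    mul_nonneg (hc _).le (sq_nonneg _)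
  -- Index 0 is a fictitious node at scale `s` where the function equals `a`, joined to node `k + 1`
  -- by an edge of energy bound `E₀`; index `i + 1` is node `k + 1 + i`. Since the scale vanishes at
  -- index 0, the size of the tail there is irrelevant.
  have key := hardy_finite M
    (fun i => match i with | 0 => 0 | i + 1 => S (k + 1 + i) - s)
    (fun i => ∑' l, w (k + i + l))
    (fun i => match i with | 0 => 0 | i + 1 => f (k + 1 + i) - a)
    (fun i => match i with
      | 0 => E₀ | i + 1 => c (k + 1 + i) * (f (k + 2 + i) - f (k + 1 + i)) ^ 2)
    K le_rfl
    (by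
      rintro (_ | i) _
      · simpa using hs
      · have h1 := hS (k + 1 + i)
        have h2 := hc (k + 1 + i)
        have : 0 < 1 / c (k + 1 + i) := by positivity
        simp only [← add_assoc]
        linarith)
    (fun i _ => tsum_nonneg fun _ => hw _)
    (fun i _ => by
      have h1 := hTd (k + i)
      have h2 := hw (k + i)
      simp only [← add_assoc]
      linarith)
    (by
      rintro (_ | i) _
      · exact hE₀
      · exact hE i)
    rfl
    (by
      rintro (_ | i) _
      · simpa using ha
      · have h1 := hS (k + 1 + i)
        have h2 := hc (k + 1 + i)
        simp only [← add_assoc]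
        rw [h1, show k + 2 + i = k + 1 + i + 1 by ring]
        apply le_of_eq
        field_simp
        ring)
    (by
      rintro (_ | i) _
      · simpa using hK
      · have := hT (k + 1 + i)
        rw [mul_comm, add_right_comm] at this
        simpa [← add_assoc, add_right_comm] using this)
  have h1 : ∀ i, (∑' l, w (k + (i + 1) + l)) - ∑' l, w (k + (i + 2) + l) = w (k + 1 + i) := by
    intro i
    have := hTd (k + 1 + i)
    rw [← this]
    simp only [show k + (i + 1) = k + 1 + i by ring, show k + (i + 2) = k + 1 + i + 1 by ring]
  simp only [h1] at key
  refine key.trans (mul_le_mul_of_nonneg_left ?_ (by positivity))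
  rcases M with _ | M
  · simpa using hE₀
  · rw [Finset.sum_range_succ', add_comm]
    gcongr
    · intro i hi _
      exact hE i
    · omega

/-- The left half of the variance estimate. -/
theorem hardy_left (w c f : ℕ → ℝ) (S : ℕ → ℝ) (K s a E₀ : ℝ) (k : ℕ)
    (hw : ∀ i, 0 ≤ w i) (hc : ∀ i, 0 < c i)
    (hS : ∀ i, S (i + 1) = S i + 1 / c i) (hK : 0 ≤ K)
    (hH : ∀ n, (∑ i ∈ Finset.range (n + 1), w i) * (s - S n) ≤ K) (hs : S k ≤ s)
    (hE₀ : 0 ≤ E₀) (ha : (f k - a) ^ 2 ≤ E₀ * (s - S k)) :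
    ∑ i ∈ Finset.range (k + 1), w i * (f i - a) ^ 2 ≤
      4 * K * (E₀ + ∑ i ∈ Finset.range k, c i * (f (i + 1) - f i) ^ 2) := by
  -- The mirror image: index 0 is the node at `s`, index `i + 1` is node `k - i`, and the heads play
  -- the role of tails.
  have key := hardy_finite (k + 1)
    (fun i => match i with | 0 => 0 | i + 1 => s - S (k - i))
    (fun i => ∑ l ∈ Finset.range (k + 2 - i), w l)
    (fun i => match i with | 0 => 0 | i + 1 => f (k - i) - a)
    (fun i => match i with
      | 0 => E₀ | i + 1 => c (k - (i + 1)) * (f (k - (i + 1) + 1) - f (k - (i + 1))) ^ 2)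
    K le_rfl
    (by
      rintro (_ | i) hi
      · simpa using hs
      · have h1 := hS (k - (i + 1))
        have h2 := hc (k - (i + 1))
        have : 0 < 1 / c (k - (i + 1)) := by positivity
        rw [show k - (i + 1) + 1 = k - i by omega] at h1
        simp only
        linarith)
    (fun i _ => Finset.sum_nonneg fun _ _ => hw _)
    (fun i _ => Finset.sum_le_sum_of_subset_of_nonneg
      (Finset.range_mono (by omega)) fun _ _ _ => hw _)
    (by
      rintro (_ | i) _
      · exact hE₀
      · exact mul_nonneg (hc _).le (sq_nonneg _))
    rfl
    (by
      rintro (_ | i) hi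
      · simpa using ha
      · have h1 := hS (k - (i + 1))
        have h2 := hc (k - (i + 1))
        rw [show k - (i + 1) + 1 = k - i by omega] at h1
        simp only
        rw [h1, show k - (i + 1) + 1 = k - i by omega]
        apply le_of_eq
        field_simp
        ring)
    (by
      rintro (_ | i) hi
      · simpa using hK
      · have := hH (k - i)
        rw [mul_comm] at this
        simpa only [show k + 2 - (i + 1) = k - i + 1 by omega] using this)
  have h1 : ∀ i ∈ Finset.range (k + 1),
      (∑ l ∈ Finset.range (k + 2 - (i + 1)), w l - ∑ l ∈ Finset.range (k + 2 - (i + 2)), w l) *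
        (f (k - i) - a) ^ 2 = w (k + 1 - 1 - i) * (f (k + 1 - 1 - i) - a) ^ 2 := by
    intro i hi
    have hi' : i < k + 1 := Finset.mem_range.1 hi
    rw [show k + 2 - (i + 1) = k - i + 1 by omega, show k + 2 - (i + 2) = k - i by omega,
      Finset.sum_range_succ, show k + 1 - 1 - i = k - i by omega]
    ring
  simp only at key
  rw [Finset.sum_congr rfl h1, Finset.sum_range_reflect (fun i => w i * (f i - a) ^ 2)] at key
  conv at key => rhs; rw [Finset.sum_range_succ' _ k]
  have h2 : ∀ i ∈ Finset.range k,
      c (k - (i + 1)) * (f (k - (i + 1) + 1) - f (k - (i + 1))) ^ 2 =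
      c (k - 1 - i) * (f (k - 1 - i + 1) - f (k - 1 - i)) ^ 2 := by
    intro i _
    rw [show k - (i + 1) = k - 1 - i by omega]
  rw [Finset.sum_congr rfl h2,
    Finset.sum_range_reflect (fun i => c i * (f (i + 1) - f i) ^ 2)] at key
  linarith

/-! ### Cutting the chain: the two-sided Poincaré inequality. -/

/-- The balanced splitting point of the scale. -/
theorem exists_balanced_point (H T S : ℕ → ℝ) (K Z : ℝ) (hK : 0 < K)
    (hH : ∀ n, 0 < H n) (hT : ∀ n, 0 ≤ T n) (hTZ : ∀ n, T n ≤ Z) (hT0 : 0 < T 0) (hS0 : S 0 = 0)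
    (hS : StrictMono S)
    (h : ∀ n m, n < m → H n * T m * (S m - S n) ≤ K * (H n + T m)) :
    ∃ s, 0 ≤ s ∧ (∃ M, s < S M) ∧ (∀ n, H n * (s - S n) ≤ K) ∧ ∀ m, T m * (S m - s) ≤ K := by
  have hSn : ∀ n, 0 ≤ S n := fun n => hS0 ▸ hS.monotone (Nat.zero_le n)
  -- Lower constraints on `s`; those with `T m = 0` are void. The point chosen is `max 0 (sSup A)`.
  let A : Set ℝ := {v | ∃ m, 0 < T m ∧ v = S m - K / T m}
  have hup : ∀ n, ∀ v ∈ A, v ≤ S n + K / H n := by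
    rintro n v ⟨m, hm, rfl⟩
    have h1 : 0 < K / H n := div_pos hK (hH n)
    have h2 : 0 < K / T m := div_pos hK hm
    rcases lt_or_ge n m with hnm | hnm
    · have h3 := h n m hnm
      have h4 : S m - S n ≤ K / H n + K / T m := by
        rw [div_add_div _ _ (hH n).ne' hm.ne', le_div_iff₀ (mul_pos (hH n) hm)]
        linarith
      linarith
    · linarith [hS.monotone hnm]
  have hne : A.Nonempty := ⟨_, 0, hT0, rfl⟩
  have hbdd : BddAbove A := ⟨_, hup 0⟩
  refine ⟨max 0 (sSup A), le_max_left _ _, ?_, ?_, ?_⟩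
  -- If no `S m` exceeded `s`, the bound `T m ≤ Z` would keep `A` at distance `K / Z` below `s`,
  -- forcing `s = 0 < S 1`.
  · by_contra! hcon
    have hZ : 0 < Z := hT0.trans_le (hTZ 0)
    have h1 : sSup A ≤ max 0 (sSup A) - K / Z := by
      apply csSup_le hne
      rintro v ⟨m, hm, rfl⟩
      have := div_le_div_of_nonneg_left hK.le hm (hTZ m)
      linarith [hcon m]
    have h2 : 0 < K / Z := div_pos hK hZ
    have h3 := hcon 1
    have h4 : S 0 < S 1 := hS Nat.zero_lt_one
    rcases max_cases 0 (sSup A) with h5 | h5 <;> linarith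
  · intro n
    have h1 : max 0 (sSup A) ≤ S n + K / H n :=
      max_le (add_nonneg (hSn n) (div_pos hK (hH n)).le) (csSup_le hne (hup n))
    calc H n * (max 0 (sSup A) - S n) ≤ H n * (K / H n) :=
          mul_le_mul_of_nonneg_left (by linarith) (hH n).le
      _ = K := mul_div_cancel₀ _ (hH n).ne'
  · intro m
    rcases (hT m).eq_or_lt with hm | hm
    · simpa [← hm] using hK.le
    · have h1 : S m - K / T m ≤ max 0 (sSup A) :=
        (le_csSup hbdd ⟨m, hm, rfl⟩).trans (le_max_right _ _)
      calc T m * (S m - max 0 (sSup A)) ≤ T m * (K / T m) :=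
            mul_le_mul_of_nonneg_left (by linarith) hm.le
        _ = K := mul_div_cancel₀ _ hm.ne'

/-- The two-sided weighted Hardy (Poincaré) inequality on `ℕ`. -/
theorem poincare_of_two_sided (w c f : ℕ → ℝ) (K : ℝ) (hK : 0 < K)
    (hw : ∀ i, 0 ≤ w i) (hw0 : 0 < w 0) (hws : Summable w) (hc : ∀ i, 0 < c i)
    (h : ∀ n m, n < m →
      (∑ i ∈ Finset.range (n + 1), w i) * (∑' i, w (m + i)) * (∑ j ∈ Finset.Ico n m, 1 / c j) ≤
        K * ((∑ i ∈ Finset.range (n + 1), w i) + ∑' i, w (m + i)))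
    (hf : HasSum (fun i => w i * f i) 0) (hf2 : Summable fun i => w i * f i ^ 2)
    (hE : Summable fun i => c i * (f (i + 1) - f i) ^ 2) :
    ∑' i, w i * f i ^ 2 ≤ 4 * K * ∑' i, c i * (f (i + 1) - f i) ^ 2 := by
  set S : ℕ → ℝ := fun m => ∑ j ∈ Finset.range m, 1 / c j with hSdef
  have hSs : ∀ i, S (i + 1) = S i + 1 / c i := fun i => Finset.sum_range_succ _ _
  have hSm : StrictMono S := strictMono_nat_of_lt_succ fun i => by
    rw [hSs]; exact lt_add_of_pos_right _ (one_div_pos.2 (hc i))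
  have hsum : ∀ m, Summable fun i => w (m + i) := fun m => by
    simpa [add_comm] using (summable_nat_add_iff m).2 hws
  have hH0 : ∀ n, 0 < ∑ i ∈ Finset.range (n + 1), w i := fun n =>
    Finset.sum_pos' (fun i _ => hw i) ⟨0, by simp, hw0⟩
  have hTZ : ∀ m, ∑' i, w (m + i) ≤ ∑' i, w i := fun m => by
    rw [← hws.sum_add_tsum_nat_add m]
    simp only [add_comm m]
    linarith [Finset.sum_nonneg fun i (_ : i ∈ Finset.range m) => hw i]
  obtain ⟨s, hs0, ⟨M, hM⟩, hsH, hsT⟩ := exists_balanced_point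
    (fun n => ∑ i ∈ Finset.range (n + 1), w i) (fun m => ∑' i, w (m + i)) S K (∑' i, w i) hK hH0
    (fun m => tsum_nonneg fun _ => hw _) hTZ
    (by simpa using hws.tsum_pos hw 0 hw0) (by simp [hSdef]) hSm
    (fun n m hnm => by
      have := h n m hnm
      rwa [Finset.sum_Ico_eq_sub _ hnm.le] at this)
  obtain ⟨k, hk1, hk2⟩ : ∃ k, S k ≤ s ∧ s < S (k + 1) := by
    classical
    have hex : ∃ M, s < S M := ⟨M, hM⟩
    have h0 : Nat.find hex ≠ 0 := by
      intro h0
      have := Nat.find_spec hex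
      rw [h0] at this
      simp only [hSdef, Finset.range_zero, Finset.sum_empty] at this
      linarith
    obtain ⟨k, hk⟩ := Nat.exists_eq_succ_of_ne_zero h0
    refine ⟨k, not_lt.1 (Nat.find_min hex (by omega)), ?_⟩
    have := Nat.find_spec hex
    rwa [hk] at this
  set D := f (k + 1) - f k with hD
  -- Linear interpolation of `f` in the scale at `s`. The energy of the cut edge then splits between
  -- the two sides in proportion to their lengths, so nothing is counted twice.
  set a := f k + D * ((s - S k) * c k) with ha
  have hck := hc k
  have hr : S (k + 1) = S k + 1 / c k := hSs k
  have hL := hardy_left w c f S K s a (c k * D ^ 2 * ((s - S k) * c k)) k hw hc hSs hK.le hsH hk1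
    (mul_nonneg (mul_nonneg hck.le (sq_nonneg _)) (mul_nonneg (by linarith) hck.le))
    (le_of_eq (by rw [ha]; ring))
  have hR := fun M => hardy_right w c f S K s a (c k * D ^ 2 * ((S (k + 1) - s) * c k)) k M hw hws
    hc hSs hK.le hsT hk2.le
    (mul_nonneg (mul_nonneg hck.le (sq_nonneg _)) (mul_nonneg (by linarith) hck.le))
    (le_of_eq (by
      have h1 : f (k + 1) - a = D * ((S (k + 1) - s) * c k) := by
        rw [ha, hr, show f (k + 1) = f k + D by rw [hD]; ring]
        field_simp
        ring
      rw [h1]; ring))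
  have hsplit : c k * D ^ 2 * ((s - S k) * c k) + c k * D ^ 2 * ((S (k + 1) - s) * c k)
      = c k * D ^ 2 := by
    rw [hr]; field_simp; ring
  have hpart : ∀ M, ∑ i ∈ Finset.range (k + 1 + M), w i * (f i - a) ^ 2 ≤
      4 * K * ∑' i, c i * (f (i + 1) - f i) ^ 2 := by
    intro M
    have h1 : ∑ i ∈ Finset.range (k + 1 + M), c i * (f (i + 1) - f i) ^ 2 ≤
        ∑' i, c i * (f (i + 1) - f i) ^ 2 :=
      hE.sum_le_tsum _ fun i _ => mul_nonneg (hc i).le (sq_nonneg _)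
    refine le_trans ?_ (mul_le_mul_of_nonneg_left h1 (by positivity))
    rw [Finset.sum_range_add _ (k + 1) M, Finset.sum_range_add _ (k + 1) M,
      Finset.sum_range_succ (fun i => c i * (f (i + 1) - f i) ^ 2) k]
    have h2 := hR M
    simp only [show ∀ i, k + 2 + i = k + 1 + i + 1 from fun i => by ring] at h2
    calc _ ≤ _ := add_le_add hL h2
      _ = 4 * K * ((∑ i ∈ Finset.range k, c i * (f (i + 1) - f i) ^ 2)
            + (c k * D ^ 2 * ((s - S k) * c k) + c k * D ^ 2 * ((S (k + 1) - s) * c k))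
            + ∑ i ∈ Finset.range M, c (k + 1 + i) * (f (k + 1 + i + 1) - f (k + 1 + i)) ^ 2) := by
          ring
      _ = _ := by rw [hsplit]
  -- As `f` has mean zero, recentring at `a` only adds the nonnegative term `a ^ 2 * ∑' i, w i`.
  have hexp : HasSum (fun i => w i * (f i - a) ^ 2)
      (∑' i, w i * f i ^ 2 - 2 * a * 0 + a ^ 2 * ∑' i, w i) := by
    have := (hf2.hasSum.sub (hf.mul_left (2 * a))).add (hws.hasSum.mul_left (a ^ 2))
    refine this.congr_fun ?_ 
    intro i
    ring
  have hlim : ∑' i, w i * f i ^ 2 - 2 * a * 0 + a ^ 2 * ∑' i, w i ≤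
      4 * K * ∑' i, c i * (f (i + 1) - f i) ^ 2 := by
    refine le_of_tendsto' (hexp.tendsto_sum_nat.comp
      (Filter.tendsto_atTop_mono (fun M => Nat.le_add_left M (k + 1)) Filter.tendsto_id)) hpart
  have : 0 ≤ a ^ 2 * ∑' i, w i := mul_nonneg (sq_nonneg _) (tsum_nonneg hw)
  linarith

/-! ### Test functions for the upper bound. -/

/-- A ramp test function for the variance: flat on `[0, n]` and `[m, ∞)`, and linear in the scale
in between. -/
theorem exists_ramp (w c : ℕ → ℝ) (n m : ℕ) (hnm : n < m) (hw : ∀ i, 0 ≤ w i) (hw0 : 0 < w 0)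
    (hws : Summable w) (hc : ∀ i, 0 < c i) (hT : 0 < ∑' i, w (m + i)) :
    ∃ (f : ℕ → ℝ) (e : ℝ), (∀ i, m ≤ i → f i = f m) ∧ HasSum (fun i => w i * f i) 0 ∧
      HasSum (fun i => w i * f i ^ 2) 1 ∧ HasSum (fun i => c i * (f (i + 1) - f i) ^ 2) e ∧
      e ≤ ((∑ i ∈ Finset.range (n + 1), w i)⁻¹ + (∑' i, w (m + i))⁻¹) *
        (∑ j ∈ Finset.Ico n m, 1 / c j)⁻¹ := by
  set H := ∑ i ∈ Finset.range (n + 1), w i with hHdef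
  set T := ∑' i, w (m + i) with hTdef
  set R := ∑ j ∈ Finset.Ico n m, 1 / c j with hRdef
  have hH : 0 < H := Finset.sum_pos' (fun i _ => hw i) ⟨0, by simp, hw0⟩
  have hci : ∀ i, 0 < 1 / c i := fun i => one_div_pos.2 (hc i)
  have hR : 0 < R := Finset.sum_pos (fun i _ => hci i) ⟨n, by simp [hnm]⟩
  set h : ℕ → ℝ := fun i => ∑ j ∈ Finset.Ico n (min i m), 1 / c j with hh
  have hlow : ∀ i ≤ n, h i = 0 := fun i hi => by
    simp only [hh]; rw [Finset.Ico_eq_empty (by omega), Finset.sum_empty]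
  have hhigh : ∀ i, m ≤ i → h i = R := fun i hi => by
    simp only [hh, min_eq_right hi, hRdef]
  have h0 : ∀ i, 0 ≤ h i := fun i => Finset.sum_nonneg fun j _ => (hci j).le
  have h1 : ∀ i, h i ≤ R := fun i => Finset.sum_le_sum_of_subset_of_nonneg
    (Finset.Ico_subset_Ico_right (min_le_right _ _)) fun j _ _ => (hci j).le
  have hstep : ∀ i, c i * (h (i + 1) - h i) ^ 2 = if i ∈ Finset.Ico n m then 1 / c i else 0 := by
    intro i
    split_ifs with hi
    · obtain ⟨hi1, hi2⟩ := Finset.mem_Ico.1 hi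
      have : h (i + 1) = h i + 1 / c i := by
        simp only [hh]
        rw [min_eq_left hi2.le, min_eq_left (Nat.succ_le_of_lt hi2), Finset.sum_Ico_succ_top hi1]
      rw [this]
      have := (hc i).ne'
      field_simp
      ring
    · rw [Finset.mem_Ico, not_and_or, not_le, not_lt] at hi
      rcases hi with hi | hi
      · rw [hlow _ hi.le, hlow _ hi]; simp
      · rw [hhigh _ hi, hhigh _ (by omega)]; simp
  have hen : HasSum (fun i => c i * (h (i + 1) - h i) ^ 2) R := by
    simp only [hstep]
    have : HasSum (fun i => if i ∈ Finset.Ico n m then 1 / c i else 0)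
        (∑ i ∈ Finset.Ico n m, if i ∈ Finset.Ico n m then 1 / c i else 0) :=
      hasSum_sum_of_ne_finset_zero fun b hb => if_neg hb
    rwa [Finset.sum_ite_mem, Finset.inter_self] at this
  set Z := ∑' i, w i with hZdef
  have hZ : 0 < Z := hws.tsum_pos hw 0 hw0
  have hs1 : Summable fun i => w i * h i :=
    Summable.of_nonneg_of_le (fun i => mul_nonneg (hw i) (h0 i))
      (fun i => mul_le_mul_of_nonneg_left (h1 i) (hw i)) (hws.mul_right R)
  have hs2 : Summable fun i => w i * h i ^ 2 :=
    Summable.of_nonneg_of_le (fun i => mul_nonneg (hw i) (sq_nonneg _))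
      (fun i => mul_le_mul_of_nonneg_left (pow_le_pow_left₀ (h0 i) (h1 i) 2) (hw i))
      (hws.mul_right (R ^ 2))
  set a := (∑' i, w i * h i) / Z with ha
  have hmean : HasSum (fun i => w i * (h i - a)) 0 := by
    have := hs1.hasSum.sub (hws.hasSum.mul_right a)
    rw [ha, mul_div_cancel₀ _ hZ.ne', sub_self] at this
    simpa only [mul_sub] using this
  have hvs : Summable fun i => w i * (h i - a) ^ 2 := by
    refine ((hs2.sub (hs1.mul_left (2 * a))).add (hws.mul_left (a ^ 2))).congr fun i => ?_
    ring
  set V := ∑' i, w i * (h i - a) ^ 2 with hV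
  -- Only the two plateaus are kept in the variance.
  have hVge : H * a ^ 2 + T * (R - a) ^ 2 ≤ V := by
    rw [hV, ← hvs.sum_add_tsum_nat_add m]
    refine add_le_add ?_ (le_of_eq ?_)
    · calc H * a ^ 2 = ∑ i ∈ Finset.range (n + 1), w i * (h i - a) ^ 2 := by
            rw [hHdef, Finset.sum_mul]
            refine Finset.sum_congr rfl fun i hi => ?_
            rw [hlow i (by simp at hi; omega)]
            ring
        _ ≤ _ := Finset.sum_le_sum_of_subset_of_nonneg (Finset.range_mono hnm)
            fun i _ _ => mul_nonneg (hw i) (sq_nonneg _)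
    · rw [hTdef, ← tsum_mul_right]
      refine tsum_congr fun i => ?_
      rw [hhigh (i + m) (by omega), add_comm m i]
  -- Minimising over `a`: `(H + T) * (H * a ^ 2 + T * (R - a) ^ 2)` exceeds `H * T * R ^ 2` by the
  -- square `(H * a - T * (R - a)) ^ 2`.
  have hVge2 : H * T * R ^ 2 ≤ V * (H + T) := by
    nlinarith [sq_nonneg (H * a - T * (R - a)), mul_le_mul_of_nonneg_right hVge (add_pos hH hT).le]
  have hVpos : 0 < V := by
    have : 0 < H * T * R ^ 2 := by positivity
    exact pos_of_mul_pos_left (this.trans_le hVge2) (add_pos hH hT).le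
  have hsq : √V ^ 2 = V := Real.sq_sqrt hVpos.le
  refine ⟨fun i => (h i - a) / √V, R / V, ?_, ?_, ?_, ?_, ?_⟩
  · intro i hi
    simp only [hhigh i hi, hhigh m le_rfl]
  · simpa [mul_div_assoc] using hmean.div_const (√V)
  · have := hvs.hasSum.div_const V
    rw [div_self hVpos.ne'] at this
    simpa only [div_pow, hsq, mul_div_assoc] using this
  · have := hen.div_const V
    refine this.congr_fun fun i => ?_
    rw [← sub_div, div_pow, hsq, mul_div_assoc, sub_sub_sub_cancel_right]
  · have : (H⁻¹ + T⁻¹) * R⁻¹ = (H + T) / (H * T * R) := by field_simp; ring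
    rw [this, div_le_div_iff₀ hVpos (by positivity)]
    nlinarith

/-! ### Transfer of the birth–death data to ℕ. -/

namespace BirthDeathRates

variable {N : ℕ∞} (X : BirthDeathRates N)

theorem mu_pos {i : ℕ} (hi : (i : ℕ∞) ≤ N) : 0 < X.mu i := by
  refine Finset.prod_pos fun j hj => ?_
  have hj' : j < i := Finset.mem_range.1 hj
  have h1 : ((j + 1 : ℕ) : ℕ∞) ≤ N := le_trans (by exact_mod_cast hj') hi
  have h2 : (j : ℕ∞) < N := lt_of_lt_of_le (by exact_mod_cast hj') hi
  exact div_pos (X.b_pos j h2) (X.a_pos _ (by omega) h1)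

theorem mu_succ_mul_a {i : ℕ} (hi : (i : ℕ∞) < N) :
    X.mu (i + 1) * X.a (i + 1) = X.mu i * X.b i := by
  have h1 : ((i + 1 : ℕ) : ℕ∞) ≤ N := by exact_mod_cast Order.add_one_le_of_lt hi
  have := (X.a_pos _ (by omega) h1).ne'
  rw [mu, Finset.prod_range_succ, ← mu]
  field_simp

/-- The measure extended by zero outside of the state space. -/
noncomputable def weight (i : ℕ) : ℝ := if (i : ℕ∞) ≤ N then X.mu i else 0

/-- The conductance of the edge `(i, i + 1)`, extended by one outside of the state space. -/
noncomputable def conductance (i : ℕ) : ℝ := if (i : ℕ∞) < N then X.mu i * X.b i else 1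

/-- The extension of a function on the state space which is constant beyond `N`. -/
noncomputable def constExt (N : ℕ∞) (f : ℕ → ℝ) (i : ℕ) : ℝ :=
  -- For `N = ⊤` the second branch is never reached, so the value of `toNat` at `⊤` is harmless.
  if (i : ℕ∞) ≤ N then f i else f N.toNat

theorem weight_nonneg (i : ℕ) : 0 ≤ X.weight i := by
  unfold weight
  split_ifs with h
  exacts [(X.mu_pos h).le, le_rfl]

theorem weight_pos {i : ℕ} (hi : (i : ℕ∞) ≤ N) : 0 < X.weight i := by
  rw [weight, if_pos hi]; exact X.mu_pos hi

theorem conductance_pos (i : ℕ) : 0 < X.conductance i := by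
  unfold conductance
  split_ifs with h
  exacts [mul_pos (X.mu_pos h.le) (X.b_pos i h), one_pos]

theorem tail_eq_tsum (m : ℕ) : X.tail m = ∑' i, ENNReal.ofReal (X.weight (m + i)) := by
  have h1 : X.tail m = ∑' i, Set.indicator {i : ℕ | m ≤ i ∧ (i : ℕ∞) ≤ N}
      (fun i => ENNReal.ofReal (X.mu i)) i :=
    tsum_subtype {i : ℕ | m ≤ i ∧ (i : ℕ∞) ≤ N} fun i => ENNReal.ofReal (X.mu i)
  rw [h1, ← ENNReal.summable.sum_add_tsum_nat_add' (k := m), Finset.sum_eq_zero, zero_add]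
  · refine tsum_congr fun i => ?_
    rw [add_comm m i]
    by_cases hi : ((i + m : ℕ) : ℕ∞) ≤ N
    · rw [Set.indicator_of_mem (by exact ⟨by omega, hi⟩), weight, if_pos hi]
    · rw [Set.indicator_of_notMem (by exact fun h => hi h.2), weight, if_neg hi,
        ENNReal.ofReal_zero]
  · intro i hi
    exact Set.indicator_of_notMem (fun h => by simp at hi; exact absurd h.1 (by omega)) _

theorem summable_weight (hZ : X.Z < ⊤) : Summable X.weight := by
  have h := hZ.ne
  rw [Z, tail_eq_tsum] at h
  have := ENNReal.summable_toReal h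
  simpa [ENNReal.toReal_ofReal, X.weight_nonneg] using this

theorem tail_eq_ofReal (hZ : X.Z < ⊤) (m : ℕ) :
    X.tail m = ENNReal.ofReal (∑' i, X.weight (m + i)) := by
  rw [tail_eq_tsum, ENNReal.ofReal_tsum_of_nonneg fun _ => X.weight_nonneg _]
  simpa [add_comm] using (summable_nat_add_iff m).2 (X.summable_weight hZ)

theorem head_eq_ofReal {n : ℕ} (hn : (n : ℕ∞) ≤ N) :
    X.head n = ENNReal.ofReal (∑ i ∈ Finset.range (n + 1), X.weight i) := by
  rw [head, ENNReal.ofReal_sum_of_nonneg fun i _ => X.weight_nonneg i]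
  refine Finset.sum_congr rfl fun i hi => ?_
  rw [weight, if_pos (le_trans (by exact_mod_cast Finset.mem_range_succ_iff.1 hi) hn)]

theorem head_pos {n : ℕ} : 0 < ∑ i ∈ Finset.range (n + 1), X.weight i :=
  Finset.sum_pos' (fun i _ => X.weight_nonneg i) ⟨0, by simp, X.weight_pos (by simp)⟩

theorem tail_pos (hZ : X.Z < ⊤) {m : ℕ} (hm : (m : ℕ∞) ≤ N) : 0 < ∑' i, X.weight (m + i) := by
  have : Summable fun i => X.weight (m + i) := by
    simpa [add_comm] using (summable_nat_add_iff m).2 (X.summable_weight hZ)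
  exact this.tsum_pos (fun _ => X.weight_nonneg _) 0 (X.weight_pos (by simpa using hm))

theorem resistance_pos {n m : ℕ} (hnm : n < m) :
    0 < ∑ j ∈ Finset.Ico n m, 1 / X.conductance j :=
  Finset.sum_pos (fun j _ => one_div_pos.2 (X.conductance_pos j)) ⟨n, by simp [hnm]⟩

theorem resistance_eq_ofReal {n m : ℕ} (hm : (m : ℕ∞) ≤ N) :
    ∑ j ∈ Finset.Ico n m, ENNReal.ofReal (1 / (X.mu j * X.b j)) =
      ENNReal.ofReal (∑ j ∈ Finset.Ico n m, 1 / X.conductance j) := by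
  rw [ENNReal.ofReal_sum_of_nonneg fun j _ => (one_div_pos.2 (X.conductance_pos j)).le]
  refine Finset.sum_congr rfl fun j hj => ?_
  rw [conductance, if_pos (lt_of_lt_of_le (by exact_mod_cast (Finset.mem_Ico.1 hj).2) hm)]

theorem ratio_eq_ofReal (hZ : X.Z < ⊤) {n m : ℕ} (hnm : n < m) (hm : (m : ℕ∞) ≤ N) :
    ((X.head n)⁻¹ + (X.tail m)⁻¹) *
      (∑ j ∈ Finset.Ico n m, ENNReal.ofReal (1 / (X.mu j * X.b j)))⁻¹ =
    ENNReal.ofReal (((∑ i ∈ Finset.range (n + 1), X.weight i)⁻¹ + (∑' i, X.weight (m + i))⁻¹) *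
        (∑ j ∈ Finset.Ico n m, 1 / X.conductance j)⁻¹) := by
  have hH := X.head_pos (n := n)
  have hT := X.tail_pos hZ hm
  have hR := X.resistance_pos hnm
  rw [X.head_eq_ofReal (le_trans (by exact_mod_cast hnm.le) hm), X.tail_eq_ofReal hZ,
    X.resistance_eq_ofReal hm, ENNReal.ofReal_mul (by positivity),
    ENNReal.ofReal_add (by positivity) (by positivity), ENNReal.ofReal_inv_of_pos hH,
    ENNReal.ofReal_inv_of_pos hT, ENNReal.ofReal_inv_of_pos hR]

theorem kappaInv_le {n m : ℕ} (hnm : n < m) (hm : (m : ℕ∞) ≤ N) :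
    X.kappaInv ≤ ((X.head n)⁻¹ + (X.tail m)⁻¹) *
      (∑ j ∈ Finset.Ico n m, ENNReal.ofReal (1 / (X.mu j * X.b j)))⁻¹ :=
  iInf₂_le_of_le n m (iInf₂_le hnm hm)

theorem one_le_N {N : ℕ∞} (X : BirthDeathRates N) : ((1 : ℕ) : ℕ∞) ≤ N := by
  have := X.N_pos
  exact_mod_cast Order.one_le_iff_pos.2 this

theorem kappaInv_ne_top (hZ : X.Z < ⊤) : X.kappaInv ≠ ⊤ := by
  have := X.kappaInv_le Nat.zero_lt_one X.one_le_N
  rw [X.ratio_eq_ofReal hZ Nat.zero_lt_one X.one_le_N] at this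
  exact (this.trans_lt ENNReal.ofReal_lt_top).ne

theorem constExt_of_le {f : ℕ → ℝ} {i : ℕ} (hi : (i : ℕ∞) ≤ N) : constExt N f i = f i :=
  if_pos hi

theorem constExt_succ_sub {f : ℕ → ℝ} {i : ℕ} (hi : ¬ (i : ℕ∞) < N) :
    constExt N f (i + 1) - constExt N f i = 0 := by
  have hi' := not_lt.1 hi
  lift N to ℕ using (fun h => by simp [h] at hi)
  have hi'' : N ≤ i := by exact_mod_cast hi'
  unfold constExt
  rw [if_neg (by norm_cast; omega)]
  split_ifs with h
  · have : i ≤ N := by exact_mod_cast h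
    obtain rfl : i = N := by omega
    simp
  · simp

theorem energy_eq_tsum (f : ℕ → ℝ) : X.energy f =
    ∑' i, ENNReal.ofReal (X.conductance i * (constExt N f (i + 1) - constExt N f i) ^ 2) := by
  have h1 : X.energy f = ∑' i, Set.indicator {i : ℕ | (i : ℕ∞) < N}
      (fun i => ENNReal.ofReal (X.mu i * X.b i * (f (i + 1) - f i) ^ 2)) i :=
    tsum_subtype {i : ℕ | (i : ℕ∞) < N}
      fun i => ENNReal.ofReal (X.mu i * X.b i * (f (i + 1) - f i) ^ 2)
  rw [h1]
  refine tsum_congr fun i => ?_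
  by_cases hi : (i : ℕ∞) < N
  · have h2 : ((i + 1 : ℕ) : ℕ∞) ≤ N := by exact_mod_cast Order.add_one_le_of_lt hi
    rw [Set.indicator_of_mem (by exact hi), conductance, if_pos hi, constExt_of_le hi.le,
      constExt_of_le h2]
  · rw [Set.indicator_of_notMem (by exact hi), constExt_succ_sub hi]
    simp

theorem hasSum_weight_iff (g g' : ℕ → ℝ) (v : ℝ) (h : ∀ i : ℕ, (i : ℕ∞) ≤ N → g i = g' i) :
    HasSum (fun i : {i : ℕ // (i : ℕ∞) ≤ N} => X.mu i * g i) v ↔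
      HasSum (fun i => X.weight i * g' i) v := by
  have h1 : HasSum (fun i : {i : ℕ // (i : ℕ∞) ≤ N} => X.mu i * g i) v ↔
      HasSum (Set.indicator {i : ℕ | (i : ℕ∞) ≤ N} fun i => X.mu i * g i) v :=
    hasSum_subtype_iff_indicator (f := fun i => X.mu i * g i) (s := {i : ℕ | (i : ℕ∞) ≤ N})
  rw [h1]
  refine iff_of_eq (congrArg (HasSum · v) (funext fun i => ?_))
  by_cases hi : (i : ℕ∞) ≤ N
  · rw [Set.indicator_of_mem (by exact hi), weight, if_pos hi, h i hi]
  · rw [Set.indicator_of_notMem (by exact hi), weight, if_neg hi, zero_mul]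

/-! ### The two bounds on `lambda1`. -/

theorem kappaInv_div_four_le_lambda1 (hZ : X.Z < ⊤) : X.kappaInv / 4 ≤ X.lambda1 := by
  refine le_iInf₂ fun f hf => ?_
  obtain ⟨⟨-, hE⟩, hf1, hf2⟩ := hf
  rcases eq_or_ne X.kappaInv 0 with h0 | h0
  · simp [h0]
  have hkt := X.kappaInv_ne_top hZ
  have hk : 0 < X.kappaInv.toReal := ENNReal.toReal_pos h0 hkt
  set F := constExt N f with hF
  have hEn : ∀ i, 0 ≤ X.conductance i * (F (i + 1) - F i) ^ 2 := fun i =>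
    mul_nonneg (X.conductance_pos i).le (sq_nonneg _)
  rw [energy_eq_tsum] at hE ⊢
  have hEs : Summable fun i => X.conductance i * (F (i + 1) - F i) ^ 2 := by
    have := ENNReal.summable_toReal hE.ne
    exact this.congr fun i => ENNReal.toReal_ofReal (hEn i)
  rw [← ENNReal.ofReal_tsum_of_nonneg hEn hEs]
  rw [X.hasSum_weight_iff f F 0 fun i hi => (constExt_of_le hi).symm] at hf1
  rw [X.hasSum_weight_iff (fun i => f i ^ 2) (fun i => F i ^ 2) 1
    fun i hi => by rw [hF, constExt_of_le hi]] at hf2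
  have key := poincare_of_two_sided X.weight X.conductance F (X.kappaInv.toReal)⁻¹
    (inv_pos.2 hk) X.weight_nonneg (X.weight_pos (by simp)) (X.summable_weight hZ)
    X.conductance_pos ?_ hf1 hf2.summable hEs
  · rw [hf2.tsum_eq] at key
    rw [← ENNReal.ofReal_toReal hkt, show (4 : ℝ≥0∞) = ENNReal.ofReal 4 by simp,
      ← ENNReal.ofReal_div_of_pos (by norm_num)]
    refine ENNReal.ofReal_le_ofReal ?_
    have : 4 * X.kappaInv.toReal⁻¹ * ∑' i, X.conductance i * (F (i + 1) - F i) ^ 2 =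
      (∑' i, X.conductance i * (F (i + 1) - F i) ^ 2) / (X.kappaInv.toReal / 4) := by
      field_simp
    rw [this, le_div_iff₀ (by positivity)] at key
    linarith
  · intro n m hnm
    have hH := X.head_pos (n := n)
    by_cases hm : (m : ℕ∞) ≤ N
    · have hT := X.tail_pos hZ hm
      have hR := X.resistance_pos hnm
      have h1 := X.kappaInv_le hnm hm
      rw [X.ratio_eq_ofReal hZ hnm hm] at h1
      have h2 := ENNReal.toReal_le_of_le_ofReal (by positivity) h1
      rw [inv_mul_eq_div, le_div_iff₀ hk]
      calc _ ≤ _ := mul_le_mul_of_nonneg_left h2 (by positivity)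
        _ = _ := by field_simp; ring
    -- Beyond `N` the tail is zero, so such pairs impose no condition.
    · have : ∀ i, X.weight (m + i) = 0 := fun i => if_neg fun h =>
        hm (le_trans (by exact_mod_cast Nat.le_add_right m i) h)
      simp only [this, tsum_zero, mul_zero, zero_mul, add_zero]
      positivity

theorem lambda1_le_kappaInv (hZ : X.Z < ⊤) : X.lambda1 ≤ X.kappaInv := by
  refine le_iInf₂ fun n m => le_iInf₂ fun hnm hm => ?_
  rw [X.ratio_eq_ofReal hZ hnm hm]
  obtain ⟨f, e, hfm, hf1, hf2, hfe, he⟩ := exists_ramp X.weight X.conductance n m hnm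
    X.weight_nonneg (X.weight_pos (by simp)) (X.summable_weight hZ) X.conductance_pos
    (X.tail_pos hZ hm)
  -- The ramp is already constant from `m ≤ N` on.
  have hext : constExt N f = f := by
    funext i
    unfold constExt
    split_ifs with hi
    · rfl
    · have h1 : N ≤ i := (not_le.1 hi).le
      lift N to ℕ using (fun h => by simp [h] at hi)
      have hm' : m ≤ N := by exact_mod_cast hm
      have hi' : N ≤ i := by exact_mod_cast h1
      rw [hfm i (by omega), ENat.toNat_natCast, hfm N hm']
  have hen : X.energy f = ENNReal.ofReal e := by
    rw [energy_eq_tsum, hext, ← hfe.tsum_eq, ENNReal.ofReal_tsum_of_nonneg _ hfe.summable]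
    exact fun i => mul_nonneg (X.conductance_pos i).le (sq_nonneg _)
  have hL2 := (X.hasSum_weight_iff (fun i => f i ^ 2) _ 1 fun _ _ => rfl).2 hf2
  refine (iInf₂_le f ⟨⟨hL2.summable, ?_⟩,
    (X.hasSum_weight_iff f _ 0 fun _ _ => rfl).2 hf1, hL2⟩).trans ?_
  · rw [hen]; exact ENNReal.ofReal_le_ofReal he
  · rw [hen]; exact ENNReal.ofReal_lt_top

/-! ### Comparison with `deltaL`, `deltaR` and `deltaAbs`. -/

theorem sum_Icc_eq {n : ℕ} (hn : (n : ℕ∞) ≤ N) :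
    ∑ i ∈ Finset.Icc 1 n, ENNReal.ofReal (1 / (X.mu i * X.a i)) =
      ∑ j ∈ Finset.Ico 0 n, ENNReal.ofReal (1 / (X.mu j * X.b j)) := by
  rw [← Finset.range_eq_Ico, Finset.range_eq_Ico, ← Finset.Ico_add_one_right_eq_Icc,
    Finset.sum_Ico_eq_sum_range, ← Finset.range_eq_Ico, Nat.add_sub_cancel]
  refine Finset.sum_congr rfl fun j hj => ?_
  rw [add_comm 1 j, X.mu_succ_mul_a (lt_of_lt_of_le (by exact_mod_cast Finset.mem_range.1 hj) hn)]

theorem inv_le_ratio {H T R d : ℝ≥0∞} (hH : H ≠ ⊤) (hR : R ≠ ⊤) (h : H * R ≤ d) :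
    d⁻¹ ≤ (H⁻¹ + T⁻¹) * R⁻¹ :=
  calc d⁻¹ ≤ (H * R)⁻¹ := ENNReal.inv_le_inv.2 h
    _ = H⁻¹ * R⁻¹ := ENNReal.mul_inv (Or.inr hR) (Or.inl hH)
    _ ≤ _ := by gcongr; exact le_self_add

/-- For each pair, drop the head reciprocal and enlarge the resistance to start at 0. -/
theorem kappa_le_deltaL (hZ : X.Z < ⊤) : X.kappa ≤ X.deltaL := by
  rw [kappa, ENNReal.inv_le_iff_inv_le]
  refine le_iInf₂ fun n m => le_iInf₂ fun hnm hm => ?_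
  rw [add_comm]
  refine inv_le_ratio (by rw [X.tail_eq_ofReal hZ]; exact ENNReal.ofReal_ne_top)
    (by rw [X.resistance_eq_ofReal hm]; exact ENNReal.ofReal_ne_top) ?_
  refine le_iSup_of_le m (le_iSup₂_of_le (by omega) hm ?_)
  rw [X.sum_Icc_eq hm, mul_comm]
  gcongr
  omega

/-- For each pair, drop the tail reciprocal and extend the resistance up to `N`. -/
theorem kappa_le_deltaR : X.kappa ≤ X.deltaR := by
  rw [kappa, ENNReal.inv_le_iff_inv_le]
  refine le_iInf₂ fun n m => le_iInf₂ fun hnm hm => ?_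
  have hn : (n : ℕ∞) < N := lt_of_lt_of_le (by exact_mod_cast hnm) hm
  refine inv_le_ratio (by rw [X.head_eq_ofReal hn.le]; exact ENNReal.ofReal_ne_top)
    (by rw [X.resistance_eq_ofReal hm]; exact ENNReal.ofReal_ne_top) ?_
  refine le_iSup₂_of_le n hn ?_
  gcongr
  have h1 : ∑' k : {k : ℕ // n ≤ k ∧ (k : ℕ∞) < N}, ENNReal.ofReal (1 / (X.mu k * X.b k)) =
      ∑' k, Set.indicator {k : ℕ | n ≤ k ∧ (k : ℕ∞) < N}
        (fun k => ENNReal.ofReal (1 / (X.mu k * X.b k))) k :=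
    tsum_subtype {k : ℕ | n ≤ k ∧ (k : ℕ∞) < N} fun k => ENNReal.ofReal (1 / (X.mu k * X.b k))
  rw [h1]
  refine (Finset.sum_congr rfl fun j hj => ?_).trans_le (ENNReal.sum_le_tsum (Finset.Ico n m))
  obtain ⟨hj1, hj2⟩ := Finset.mem_Ico.1 hj
  rw [Set.indicator_of_mem]
  exact ⟨hj1, lt_of_lt_of_le (by exact_mod_cast hj2) hm⟩

/-- Test κ with the pairs `(0, m)`: the head is `μ 0 = 1`, and `1 + 1 / T = (1 + T) / T ≤ Z / T`
because `m ≥ 1`. -/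
theorem Z_inv_mul_deltaL_le_kappa (hZ : X.Z < ⊤) : X.Z⁻¹ * X.deltaL ≤ X.kappa := by
  rw [deltaL]
  simp only [ENNReal.mul_iSup]
  refine iSup_le fun m => iSup₂_le fun hm1 hm => ?_
  rw [kappa, ENNReal.le_inv_iff_le_inv]
  refine (X.kappaInv_le hm1 hm).trans ?_
  have hT := X.tail_pos hZ hm
  have hR := X.resistance_pos hm1
  have hws := X.summable_weight hZ
  have hZ1 := X.tail_pos hZ (m := 0) (by simp)
  rw [X.ratio_eq_ofReal hZ hm1 hm, X.sum_Icc_eq hm, X.resistance_eq_ofReal hm,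
    X.tail_eq_ofReal hZ, Z, X.tail_eq_ofReal hZ, ← ENNReal.ofReal_inv_of_pos hZ1,
    ← ENNReal.ofReal_mul hR.le, ← ENNReal.ofReal_mul (by positivity),
    ← ENNReal.ofReal_inv_of_pos (by positivity)]
  refine ENNReal.ofReal_le_ofReal ?_
  have h0 : X.weight 0 = 1 := by simp [weight, mu]
  have h1 : 1 + ∑' i, X.weight (m + i) ≤ ∑' i, X.weight (0 + i) := by
    simp only [zero_add]
    rw [← hws.sum_add_tsum_nat_add m]
    simp only [add_comm m]
    gcongr
    rw [← h0]
    exact Finset.single_le_sum (fun i _ => X.weight_nonneg i) (Finset.mem_range.2 hm1)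
  simp only [zero_add, Finset.sum_range_one, h0] at h1 hZ1 ⊢
  set T := ∑' i, X.weight (m + i)
  set R := ∑ j ∈ Finset.Ico 0 m, 1 / X.conductance j
  rw [show (1⁻¹ + T⁻¹) * R⁻¹ = (1 + T) * (R * T)⁻¹ by field_simp; ring, mul_inv (_)⁻¹,
    inv_inv]
  gcongr

theorem mu_eq_mul_muAbs {n : ℕ} (hn : 1 ≤ n) : X.mu n = X.b 0 / X.a 1 * X.muAbs n := by
  rw [mu, muAbs, Finset.range_eq_Ico, Finset.prod_eq_prod_Ico_succ_bot (by omega)]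

/-- The two measures differ by the factor `b 0 / a 1`, which cancels between resistance and tail. -/
theorem deltaL_eq_deltaAbs : X.deltaL = X.deltaAbs := by
  set q := X.b 0 / X.a 1 with hq
  have hqpos : 0 < q := div_pos (X.b_pos 0 (by simpa using X.N_pos)) (X.a_pos 1 le_rfl X.one_le_N)
  refine iSup_congr fun n => iSup_congr fun hn => iSup_congr fun hnN => ?_
  have h1 : ∑ i ∈ Finset.Icc 1 n, ENNReal.ofReal (1 / (X.muAbs i * X.a i)) =
      ENNReal.ofReal q * ∑ i ∈ Finset.Icc 1 n, ENNReal.ofReal (1 / (X.mu i * X.a i)) := by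
    rw [Finset.mul_sum]
    refine Finset.sum_congr rfl fun i hi => ?_
    rw [← ENNReal.ofReal_mul hqpos.le, X.mu_eq_mul_muAbs (Finset.mem_Icc.1 hi).1, ← hq, mul_assoc,
      mul_one_div, ← div_div q q, div_self hqpos.ne']
  have h2 : X.tail n = ENNReal.ofReal q *
      ∑' j : {j : ℕ // n ≤ j ∧ (j : ℕ∞) ≤ N}, ENNReal.ofReal (X.muAbs j) := by
    rw [tail, ← ENNReal.tsum_mul_left]
    refine tsum_congr fun j => ?_
    rw [← ENNReal.ofReal_mul hqpos.le, X.mu_eq_mul_muAbs (hn.trans j.2.1)]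
  rw [h1, h2]
  ring

end BirthDeathRates

theorem corollary6p6 (N : ℕ∞) (X : BirthDeathRates N) (hZ : X.Z < ⊤) :
    (X.kappa⁻¹ / 4 ≤ X.lambda1 ∧ X.lambda1 ≤ X.kappa⁻¹) ∧
    (X.kappa ≤ min X.deltaL X.deltaR ∧ X.Z⁻¹ * X.deltaL ≤ X.kappa) ∧
    X.deltaL = X.deltaAbs := by
  have hk : X.kappa⁻¹ = X.kappaInv := inv_inv _
  rw [hk]
  exact ⟨⟨X.kappaInv_div_four_le_lambda1 hZ, X.lambda1_le_kappaInv hZ⟩,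
    ⟨le_min (X.kappa_le_deltaL hZ) X.kappa_le_deltaR, X.Z_inv_mul_deltaL_le_kappa hZ⟩,
    X.deltaL_eq_deltaAbs⟩
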